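/- A three-colored partition of a non-negative integer $n$ is a finite multiset of parts, each part being a positive integer $j$ carrying one of the colors $R,G,B$ (written $j_R,j_G,j_B$), whose sizes sum to $n$. Let $\Gamma$ be the set of three-colored partitions in which the sizes of all parts are distinct (for each $j$, at most one total copy of $j_R,j_G,j_B$ occurs) and which, for every $j$, contain none of the following pairs of parts: $$j_R+(j+1)_R,\quad j_R+(j+2)_R,\quad j_R+(j+1)_B,\quad j_G+(j+1)_R,\quad j_G+(j+2)_R,\quad j_G+(j+1)_B,\quad j_B+(j+1)_R,\quad j_B+(j+1)_G.$$ Let $A^\ast(n)$ be the number of three-colored partitions of $n$ in $\Gamma$ with no occurrences of $1_R$, $2_R$ and $1_B$. Then, as formal power series in $q$, $$\sum_{n\ge 0}A^\ast(n)\,q^n=\frac{1}{(q;q^2)_\infty\,(q^2,q^3;q^5)_\infty},$$ where $(a;q)_\infty=\prod_{j\ge 1}(1-aq^{j-1})$ and $(a_1,a_2;q)_\infty=(a_1;q)_\infty(a_2;q)_\infty$. -/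

import Mathlib

open scoped PowerSeries PowerSeries.WithPiTopology

/-- The three colors. -/
inductive PartColor : Type where
  | R : PartColor
  | G : PartColor
  | B : PartColor
  deriving DecidableEq

instance PartColor.instFintype : Fintype PartColor where
  elems := {.R, .G, .B}
  complete := by intro c; cases c <;> simp

/-- A three-colored partition of `n`: a finite multiset of colored parts `(j, c)` (the part `j` in
color `c`), where every `j` is a positive integer and the sizes `j` sum to `n`. -/
structure ColoredPartition (n : ℕ) : Type where
  parts : Multiset (ℕ × PartColor)
  parts_pos : ∀ p ∈ parts, 0 < p.1
  parts_sum : (parts.map Prod.fst).sum = n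

/-- The multiset of colored parts contains the subpartition `j_c + k_d` (for `j ≠ k`). -/
def ContainsPair (s : Multiset (ℕ × PartColor)) (j : ℕ) (c : PartColor) (k : ℕ) (d : PartColor) :
    Prop :=
  (j, c) ∈ s ∧ (k, d) ∈ s

/-- Membership in the set `Γ` of three-colored partitions. -/
structure ColoredPartition.MemGamma {n : ℕ} (p : ColoredPartition n) : Prop where
  /-- The sizes of all parts are distinct (whatever their colors). -/
  distinct : (p.parts.map Prod.fst).Nodup
  /-- No `j_R + (j+1)_R`. -/
  not_RR_one : ∀ j : ℕ, ¬ ContainsPair p.parts j .R (j + 1) .R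
  /-- No `j_R + (j+2)_R`. -/
  not_RR_two : ∀ j : ℕ, ¬ ContainsPair p.parts j .R (j + 2) .R
  /-- No `j_R + (j+1)_B`. -/
  not_RB_one : ∀ j : ℕ, ¬ ContainsPair p.parts j .R (j + 1) .B
  /-- No `j_G + (j+1)_R`. -/
  not_GR_one : ∀ j : ℕ, ¬ ContainsPair p.parts j .G (j + 1) .R
  /-- No `j_G + (j+2)_R`. -/
  not_GR_two : ∀ j : ℕ, ¬ ContainsPair p.parts j .G (j + 2) .R
  /-- No `j_G + (j+1)_B`. -/
  not_GB_one : ∀ j : ℕ, ¬ ContainsPair p.parts j .G (j + 1) .B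
  /-- No `j_B + (j+1)_R`. -/
  not_BR_one : ∀ j : ℕ, ¬ ContainsPair p.parts j .B (j + 1) .R
  /-- No `j_B + (j+1)_G`. -/
  not_BG_one : ∀ j : ℕ, ¬ ContainsPair p.parts j .B (j + 1) .G

/-- There are finitely many three-colored partitions of `n`, so counting them is meaningful. -/
instance ColoredPartition.instFinite (n : ℕ) : Finite (ColoredPartition n) := by
  classical
  let U : Multiset (ℕ × PartColor) :=
    n • (Finset.range (n + 1) ×ˢ (Finset.univ : Finset PartColor)).val
  let f : ColoredPartition n → {s // s ∈ U.powerset.toFinset} := fun p =>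
    ⟨p.parts, by
      rw [Multiset.mem_toFinset, Multiset.mem_powerset, Multiset.le_iff_count]
      intro a
      by_cases ha : a ∈ p.parts
      · have h1 : a.1 ≤ n := by
          have := Multiset.single_le_sum (s := p.parts.map Prod.fst) (fun _ _ => Nat.zero_le _)
            a.1 (Multiset.mem_map_of_mem _ ha)
          rwa [p.parts_sum] at this
        have h2 : p.parts.card ≤ n := by
          have h3 : (p.parts.map Prod.fst).card • 1 ≤ (p.parts.map Prod.fst).sum := by
            apply Multiset.card_nsmul_le_sum
            intro x hx
            obtain ⟨y, hy, rfl⟩ := Multiset.mem_map.mp hx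
            exact p.parts_pos y hy
          rw [p.parts_sum] at h3
          simpa using h3
        have h4 : a ∈ (Finset.range (n + 1) ×ˢ (Finset.univ : Finset PartColor)).val := by
          simp only [Finset.mem_val, Finset.mem_product, Finset.mem_range, Finset.mem_univ,
            and_true]
          omega
        have h5 := Multiset.one_le_count_iff_mem.mpr h4
        calc p.parts.count a ≤ n := (Multiset.count_le_card _ _).trans h2
          _ ≤ U.count a := by
            rw [Multiset.count_nsmul]
            exact Nat.le_mul_of_pos_right _ h5
      · simp [Multiset.count_eq_zero_of_notMem ha]⟩
  refine Finite.of_injective f ?_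
  rintro ⟨s, _, _⟩ ⟨t, _, _⟩ h
  simpa [f] using h

/-- `A*(n)`: the number of three-colored partitions of `n` that lie in `Γ` and have no occurrences
of `1_R`, `2_R` and `1_B`. -/
noncomputable def AStar (n : ℕ) : ℕ :=
  Set.ncard {p : ColoredPartition n |
    p.MemGamma ∧ (1, .R) ∉ p.parts ∧ (2, .R) ∉ p.parts ∧ (1, .B) ∉ p.parts}

/-- The infinite `q`-Pochhammer symbol `(a; q)_∞ = ∏_{j ≥ 0} (1 - a q ^ j)` of formal power series
with integer coefficients (in the topology of coefficientwise stabilization). -/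
noncomputable def qPochhammerInf (a q : ℤ⟦X⟧) : ℤ⟦X⟧ :=
  ∏' j : ℕ, (1 - a * q ^ j)

/-- The product that defines `(a; q)_∞` converges when `q` has no constant term. -/
theorem multipliable_qPochhammerInf (a q : ℤ⟦X⟧) (hq : PowerSeries.constantCoeff q = 0) :
    Multipliable fun j : ℕ => 1 - a * q ^ j := by
  simp_rw [sub_eq_add_neg]
  apply PowerSeries.WithPiTopology.multipliable_one_add_of_tendsto_order_atTop_nhds_top
  rw [ENat.tendsto_nhds_top_iff_natCast_lt]
  intro m
  filter_upwards [Filter.eventually_gt_atTop m] with j hj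
  have h1 : ((j : ℕ) : ℕ∞) ≤ (q ^ j).order := PowerSeries.le_order_pow_of_constantCoeff_eq_zero j hq
  have h2 : a.order + (q ^ j).order ≤ (a * q ^ j).order := PowerSeries.le_order_mul _ _
  rw [PowerSeries.order_neg]
  calc (m : ℕ∞) < j := by exact_mod_cast hj
    _ ≤ (q ^ j).order := h1
    _ ≤ a.order + (q ^ j).order := le_add_self
    _ ≤ _ := h2

/-! The conditions of `Γ`, on parts of distinct sizes, say that each part exceeds any smaller one by
at least an amount `minDiff` depending on their two colors. Forbidding `1_R`, `2_R`, `1_B` means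
exactly that every part may stand above a fictitious part `0_R`.

Let `E k` and `D k` be the generating functions of the admissible sets whose parts may all stand
above `k_R`, respectively `k_B`. Splitting off smallest parts gives two coupled q-difference
equations (`weightGenFun_red`, `weightGenFun_blue`). Both functions are 1 modulo `X ^ k`, so the
equations determine them (`eq_redSeries_of_rec`), and explicit series solve the same system
(`redSeries_rec`, `blueSeries_rec`). At `k = 0` the solution collapses to `(-q)_∞ ∑ q^(n²+n)/(q)_n`.

It remains to prove the second Rogers–Ramanujan identity. The Rogers–Selberg recurrence turns the
sum into a theta series (`hasSum_thetaTerm`), a case of the Jacobi triple product evaluates that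
series (`rogersRamanujanSum_zero`), and Euler's `(-q; q)_∞ (q; q²)_∞ = 1` finishes the proof. Sums
are multiplied by `(q)_∞` throughout, so that `(q)_∞/(q)_n` becomes `qTail n` and no division
occurs. -/

open PowerSeries

/-! ### Congruences modulo powers of `X` and infinite sums. -/

theorem isClosed_setOf_X_pow_dvd (n : ℕ) : IsClosed {f : ℤ⟦X⟧ | (X : ℤ⟦X⟧) ^ n ∣ f} := by
  simp only [X_pow_dvd_iff, Set.ofPred_forall]
  exact isClosed_iInter fun i => isClosed_iInter fun _ =>
    isClosed_singleton.preimage (WithPiTopology.continuous_coeff ℤ i)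

theorem eq_zero_of_forall_X_pow_dvd {f : ℤ⟦X⟧} (h : ∀ n, (X : ℤ⟦X⟧) ^ n ∣ f) : f = 0 := by
  ext n
  simpa using X_pow_dvd_iff.mp (h (n + 1)) n n.lt_succ_self

theorem eq_of_forall_X_pow_dvd_sub {f g : ℤ⟦X⟧} (h : ∀ n, (X : ℤ⟦X⟧) ^ n ∣ f - g) : f = g :=
  sub_eq_zero.mp (eq_zero_of_forall_X_pow_dvd h)

/-- A family indexed by `k` that is divisible by `X ^ k` and whose divisibility at `k` follows from
that at larger indices vanishes. -/
theorem forall_X_pow_dvd_of_later {f : ℕ → ℤ⟦X⟧} (h0 : ∀ k, (X : ℤ⟦X⟧) ^ k ∣ f k)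
    (h : ∀ n k, (∀ i, k < i → (X : ℤ⟦X⟧) ^ n ∣ f i) → (X : ℤ⟦X⟧) ^ n ∣ f k) (n k : ℕ) :
    (X : ℤ⟦X⟧) ^ n ∣ f k := by
  have key : ∀ j k, n ≤ k + j → (X : ℤ⟦X⟧) ^ n ∣ f k := by
    intro j
    induction j with
    | zero => intro k hk; exact (pow_dvd_pow X (by simpa using hk)).trans (h0 k)
    | succ j ih => intro k hk; exact h n k fun i hi => ih i (by omega)
  exact key n k (by omega)

theorem HasSum.X_pow_dvd {ι : Type*} {f : ι → ℤ⟦X⟧} {s : ℤ⟦X⟧} {n : ℕ} (hs : HasSum f s)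
    (h : ∀ i, (X : ℤ⟦X⟧) ^ n ∣ f i) : (X : ℤ⟦X⟧) ^ n ∣ s :=
  (isClosed_setOf_X_pow_dvd n).mem_of_tendsto hs
    (Filter.Eventually.of_forall fun _ => Finset.dvd_sum fun i _ => h i)

theorem summable_of_X_pow_dvd {f : ℕ → ℤ⟦X⟧} (h : ∀ n, (X : ℤ⟦X⟧) ^ n ∣ f n) : Summable f := by
  apply WithPiTopology.summable_of_tendsto_order_atTop_nhds_top
  rw [ENat.tendsto_nhds_top_iff_natCast_lt]
  intro m
  filter_upwards [Filter.eventually_gt_atTop m] with j hj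
  exact lt_of_lt_of_le (Nat.cast_lt.mpr hj) (nat_le_order _ j (X_pow_dvd_iff.mp (h j)))

theorem hasSum_sub_succ {t : ℕ → ℤ⟦X⟧} (h : ∀ n, (X : ℤ⟦X⟧) ^ n ∣ t n) :
    HasSum (fun n => t n - t (n + 1)) (t 0) := by
  have h1 : Summable fun n => t (n + 1) := (summable_nat_add_iff 1).mpr (summable_of_X_pow_dvd h)
  have h2 := (h1.hasSum.zero_add).sub h1.hasSum
  rwa [add_sub_cancel_right] at h2

/-! ### Infinite products and Euler's identity. -/

theorem X_pow_dvd_qPochhammerInf_sub_one {a q : ℤ⟦X⟧} {m : ℕ} (ha : (X : ℤ⟦X⟧) ^ m ∣ a)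
    (hq : constantCoeff q = 0) : (X : ℤ⟦X⟧) ^ m ∣ qPochhammerInf a q - 1 := by
  have hc : IsClosed {f : ℤ⟦X⟧ | (X : ℤ⟦X⟧) ^ m ∣ f - 1} :=
    (isClosed_setOf_X_pow_dvd m).preimage (continuous_id.sub continuous_const)
  refine hc.mem_of_tendsto (multipliable_qPochhammerInf a q hq).hasProd
    (Filter.Eventually.of_forall fun s => ?_)
  classical
  simp only [Set.mem_ofPred_eq]
  induction s using Finset.induction_on with
  | empty => simp
  | insert i s hi ih =>
    rw [Finset.prod_insert hi]
    have e : (1 - a * q ^ i) * ∏ j ∈ s, (1 - a * q ^ j) - 1 =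
      (∏ j ∈ s, (1 - a * q ^ j) - 1) - a * (q ^ i * ∏ j ∈ s, (1 - a * q ^ j)) := by ring
    rw [e]
    exact dvd_sub ih (ha.mul_right _)

theorem qPochhammerInf_eq_mul (a : ℤ⟦X⟧) {q : ℤ⟦X⟧} (hq : constantCoeff q = 0) :
    qPochhammerInf a q = (1 - a) * qPochhammerInf (a * q) q := by
  have e : ∀ j : ℕ, 1 - a * q * q ^ j = 1 - a * q ^ (j + 1) := fun j => by ring
  unfold qPochhammerInf
  rw [tprod_eq_zero_mul']
  · simp only [pow_zero, mul_one, e]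
  · simpa only [e] using multipliable_qPochhammerInf (a * q) q hq

theorem qPochhammerInf_ne_zero {a q : ℤ⟦X⟧} (ha : (X : ℤ⟦X⟧) ∣ a) (hq : constantCoeff q = 0) :
    qPochhammerInf a q ≠ 0 := by
  intro h
  have := X_pow_dvd_qPochhammerInf_sub_one (m := 1) (by simpa using ha) hq
  rw [h, pow_one, zero_sub, X_dvd_iff] at this
  simp at this

/-- `(q ^ (n + 1); q)_∞`. -/
noncomputable def qTail (n : ℕ) : ℤ⟦X⟧ := qPochhammerInf (X ^ (n + 1)) X

/-- `(-q ^ (n + 1); q)_∞`. -/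
noncomputable def qTailNeg (n : ℕ) : ℤ⟦X⟧ := qPochhammerInf (-X ^ (n + 1)) X

/-- `(q; q)_n`. -/
noncomputable def qFact (n : ℕ) : ℤ⟦X⟧ := ∏ i ∈ Finset.range n, (1 - X ^ (i + 1))

/-- `(-q; q)_n`. -/
noncomputable def qFactNeg (n : ℕ) : ℤ⟦X⟧ := ∏ i ∈ Finset.range n, (1 + X ^ (i + 1))

theorem qTail_eq_mul (n : ℕ) : qTail n = (1 - X ^ (n + 1)) * qTail (n + 1) := by
  rw [qTail, qPochhammerInf_eq_mul _ (by simp), ← pow_succ, qTail]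

theorem qTailNeg_eq_mul (n : ℕ) : qTailNeg n = (1 + X ^ (n + 1)) * qTailNeg (n + 1) := by
  rw [qTailNeg, qPochhammerInf_eq_mul _ (by simp), neg_mul, ← pow_succ, qTailNeg, sub_neg_eq_add]

theorem qFact_succ (n : ℕ) : qFact (n + 1) = (1 - X ^ (n + 1)) * qFact n := by
  rw [qFact, Finset.prod_range_succ, mul_comm, qFact]

theorem qFactNeg_succ (n : ℕ) : qFactNeg (n + 1) = (1 + X ^ (n + 1)) * qFactNeg n := by
  rw [qFactNeg, Finset.prod_range_succ, mul_comm, qFactNeg]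

@[simp] theorem qFact_zero : qFact 0 = 1 := by simp [qFact]

@[simp] theorem qFactNeg_zero : qFactNeg 0 = 1 := by simp [qFactNeg]

theorem X_pow_dvd_qTail_sub_one (n : ℕ) : (X : ℤ⟦X⟧) ^ (n + 1) ∣ qTail n - 1 :=
  X_pow_dvd_qPochhammerInf_sub_one dvd_rfl (by simp)

theorem X_pow_dvd_qTailNeg_sub_one (n : ℕ) : (X : ℤ⟦X⟧) ^ (n + 1) ∣ qTailNeg n - 1 :=
  X_pow_dvd_qPochhammerInf_sub_one (dvd_neg.mpr dvd_rfl) (by simp)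

theorem qTail_zero_ne_zero : qTail 0 ≠ 0 := qPochhammerInf_ne_zero (by simp) (by simp)

theorem qFact_mul_qTail (n : ℕ) : qFact n * qTail n = qTail 0 := by
  induction n with
  | zero => simp
  | succ n ih => rw [← ih, qFact_succ, qTail_eq_mul n]; ring

theorem qFactNeg_mul_qTailNeg (n : ℕ) : qFactNeg n * qTailNeg n = qTailNeg 0 := by
  induction n with
  | zero => simp
  | succ n ih => rw [← ih, qFactNeg_succ, qTailNeg_eq_mul n]; ring

theorem X_pow_dvd_qFact_sub (n : ℕ) : (X : ℤ⟦X⟧) ^ n ∣ qFact n - qTail 0 := by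
  have e : qFact n - qTail 0 = -(qFact n * (qTail n - 1)) := by rw [← qFact_mul_qTail n]; ring
  rw [e, dvd_neg]
  exact ((pow_dvd_pow X n.le_succ).trans (X_pow_dvd_qTail_sub_one n)).mul_left _

/-- Modulo `X ^ n` the two agree for `k ≥ n`, and the common recurrence carries this down to every
`k`. The product identities below come from it by letting the starting exponents of all factors grow
with `k`. -/
theorem eq_of_forall_eq_mul_succ {A B c : ℕ → ℤ⟦X⟧} (h : ∀ k, (X : ℤ⟦X⟧) ^ k ∣ A k - B k)
    (hA : ∀ k, A k = c k * A (k + 1)) (hB : ∀ k, B k = c k * B (k + 1)) (k : ℕ) : A k = B k := by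
  refine eq_of_forall_X_pow_dvd_sub fun n => ?_
  refine forall_X_pow_dvd_of_later h (fun n k ih => ?_) n k
  rw [hA, hB, ← mul_sub]
  exact (ih _ k.lt_succ_self).mul_left _

theorem dvd_mul_sub_one {d a b : ℤ⟦X⟧} (ha : d ∣ a - 1) (hb : d ∣ b - 1) : d ∣ a * b - 1 := by
  have e : a * b - 1 = (a - 1) * b + (b - 1) := by ring
  rw [e]
  exact (ha.mul_right _).add hb

theorem dvd_sub_of_dvd_sub_one {d a b : ℤ⟦X⟧} (ha : d ∣ a - 1) (hb : d ∣ b - 1) : d ∣ a - b := by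
  simpa using dvd_sub ha hb

theorem X_pow_dvd_qPochhammerInf_X_pow {m i j : ℕ} (h : m ≤ i) (hj : j ≠ 0) :
    (X : ℤ⟦X⟧) ^ m ∣ qPochhammerInf (X ^ i) (X ^ j) - 1 :=
  X_pow_dvd_qPochhammerInf_sub_one (pow_dvd_pow X h) (by simp [hj])

theorem qPochhammerInf_X_pow_eq_mul (i : ℕ) {j : ℕ} (hj : j ≠ 0) :
    qPochhammerInf (X ^ i) (X ^ j) = (1 - X ^ i) * qPochhammerInf (X ^ (i + j)) (X ^ j) := by
  rw [qPochhammerInf_eq_mul _ (by simp [hj]), ← pow_add]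

theorem qTailNeg_zero_mul_qTail_zero : qTailNeg 0 * qTail 0 = qPochhammerInf (X ^ 2) (X ^ 2) := by
  refine eq_of_forall_eq_mul_succ (A := fun k => qTailNeg k * qTail k)
    (B := fun k => qPochhammerInf (X ^ (2 * k + 2)) (X ^ 2)) (c := fun k => 1 - X ^ (2 * k + 2))
    (fun k => ?_) (fun k => ?_) (fun k => ?_) 0
  · exact dvd_sub_of_dvd_sub_one (dvd_mul_sub_one
      ((pow_dvd_pow X k.le_succ).trans (X_pow_dvd_qTailNeg_sub_one k))
      ((pow_dvd_pow X k.le_succ).trans (X_pow_dvd_qTail_sub_one k)))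
      (X_pow_dvd_qPochhammerInf_X_pow (by omega) two_ne_zero)
  · rw [qTailNeg_eq_mul, qTail_eq_mul k]
    ring
  · exact qPochhammerInf_X_pow_eq_mul _ two_ne_zero

theorem qPochhammerInf_even_mul_odd :
    qPochhammerInf X (X ^ 2) * qPochhammerInf (X ^ 2) (X ^ 2) = qTail 0 := by
  have h := eq_of_forall_eq_mul_succ
    (A := fun k => qPochhammerInf (X ^ (2 * k + 1)) (X ^ 2) *
      qPochhammerInf (X ^ (2 * k + 2)) (X ^ 2))
    (B := fun k => qTail (2 * k)) (c := fun k => (1 - X ^ (2 * k + 1)) * (1 - X ^ (2 * k + 2)))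
    (fun k => ?_) (fun k => ?_) (fun k => ?_) 0
  · simpa using h
  · exact dvd_sub_of_dvd_sub_one (dvd_mul_sub_one
      (X_pow_dvd_qPochhammerInf_X_pow (by omega) two_ne_zero)
      (X_pow_dvd_qPochhammerInf_X_pow (by omega) two_ne_zero))
      ((pow_dvd_pow X (by omega)).trans (X_pow_dvd_qTail_sub_one (2 * k)))
  · rw [qPochhammerInf_X_pow_eq_mul (2 * k + 1) two_ne_zero,
      qPochhammerInf_X_pow_eq_mul (2 * k + 2) two_ne_zero]
    ring_nf
  · rw [qTail_eq_mul (2 * k), qTail_eq_mul (2 * k + 1)]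
    ring_nf

/-- Euler: `(-q; q)_∞ (q; q²)_∞ = 1`. -/
theorem qTailNeg_zero_mul_qPochhammerInf : qTailNeg 0 * qPochhammerInf X (X ^ 2) = 1 := by
  have h := qPochhammerInf_even_mul_odd
  rw [← qTailNeg_zero_mul_qTail_zero] at h
  apply mul_right_cancel₀ qTail_zero_ne_zero
  linear_combination h

theorem qTail_zero_eq_prod_mod_five :
    qPochhammerInf X (X ^ 5) * qPochhammerInf (X ^ 2) (X ^ 5) * qPochhammerInf (X ^ 3) (X ^ 5) *
      qPochhammerInf (X ^ 4) (X ^ 5) * qPochhammerInf (X ^ 5) (X ^ 5) = qTail 0 := by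
  have h5 : (5 : ℕ) ≠ 0 := by norm_num
  have h := eq_of_forall_eq_mul_succ
    (A := fun k => qPochhammerInf (X ^ (5 * k + 1)) (X ^ 5) *
      qPochhammerInf (X ^ (5 * k + 2)) (X ^ 5) * qPochhammerInf (X ^ (5 * k + 3)) (X ^ 5) *
      qPochhammerInf (X ^ (5 * k + 4)) (X ^ 5) * qPochhammerInf (X ^ (5 * k + 5)) (X ^ 5))
    (B := fun k => qTail (5 * k))
    (c := fun k => (1 - X ^ (5 * k + 1)) * (1 - X ^ (5 * k + 2)) * (1 - X ^ (5 * k + 3)) *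
      (1 - X ^ (5 * k + 4)) * (1 - X ^ (5 * k + 5)))
    (fun k => ?_) (fun k => ?_) (fun k => ?_) 0
  · simpa using h
  · have hm : ∀ i, (X : ℤ⟦X⟧) ^ k ∣ qPochhammerInf (X ^ (5 * k + i)) (X ^ 5) - 1 := fun i =>
      X_pow_dvd_qPochhammerInf_X_pow (by omega) h5
    exact dvd_sub_of_dvd_sub_one (dvd_mul_sub_one (dvd_mul_sub_one (dvd_mul_sub_one
      (dvd_mul_sub_one (hm 1) (hm 2)) (hm 3)) (hm 4)) (hm 5))
      ((pow_dvd_pow X (by omega)).trans (X_pow_dvd_qTail_sub_one (5 * k)))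
  · have hm : ∀ i, qPochhammerInf (X ^ (5 * k + i)) (X ^ 5) =
        (1 - X ^ (5 * k + i)) * qPochhammerInf (X ^ (5 * (k + 1) + i)) (X ^ 5) := fun i => by
      rw [qPochhammerInf_X_pow_eq_mul _ h5]
      ring_nf
    rw [hm 1, hm 2, hm 3, hm 4, hm 5]
    ring
  · rw [qTail_eq_mul (5 * k), qTail_eq_mul (5 * k + 1), qTail_eq_mul (5 * k + 2),
      qTail_eq_mul (5 * k + 3), qTail_eq_mul (5 * k + 4), mul_add 5 k 1]
    ring

/-! ### The Rogers–Ramanujan sum as a theta series. -/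

theorem choose_two_succ (n : ℕ) : (n + 1).choose 2 = n + n.choose 2 := by
  rw [Nat.choose_succ_succ' n 1, Nat.choose_one_right]

theorem HasSum.eq_of_telescope {f t : ℕ → ℤ⟦X⟧} {s : ℤ⟦X⟧} (h : HasSum f s)
    (ht : ∀ n, (X : ℤ⟦X⟧) ^ n ∣ t n) (e : ∀ n, f n = t n - t (n + 1)) : s = t 0 := by
  rw [funext e] at h
  exact h.unique (hasSum_sub_succ ht)

theorem eq_of_forall_eq_add_succ_succ {A B c : ℕ → ℤ⟦X⟧}
    (h : ∀ k, (X : ℤ⟦X⟧) ^ k ∣ A k - B k)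
    (hA : ∀ k, A k = A (k + 1) + c k * A (k + 2)) (hB : ∀ k, B k = B (k + 1) + c k * B (k + 2))
    (k : ℕ) : A k = B k := by
  refine eq_of_forall_X_pow_dvd_sub fun n => ?_
  refine forall_X_pow_dvd_of_later h (fun n k ih => ?_) n k
  have e : A k - B k = (A (k + 1) - B (k + 1)) + c k * (A (k + 2) - B (k + 2)) := by
    rw [hA k, hB k]; ring
  rw [e]
  exact (ih _ (by omega)).add ((ih _ (by omega)).mul_left _)

/-- `(q)_∞ ∑ q ^ (n² + (k + 1) n) / (q)_n`. -/
noncomputable def rogersRamanujanSum (k : ℕ) : ℤ⟦X⟧ :=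
  ∑' n : ℕ, X ^ (n ^ 2 + (k + 1) * n) * qTail n

theorem hasSum_rogersRamanujanSum (k : ℕ) :
    HasSum (fun n : ℕ => X ^ (n ^ 2 + (k + 1) * n) * qTail n) (rogersRamanujanSum k) :=
  (summable_of_X_pow_dvd fun n => (pow_dvd_pow X (by nlinarith)).mul_right _).hasSum

/-- The first two sums differ by a factor `1 - X ^ n` in each term, which turns `1/(q)_n` into
`1/(q)_{n-1}`; shifting `n` gives the third sum. The telescoping term records this shift and
vanishes at 0. -/
theorem rogersRamanujanSum_rec (k : ℕ) :
    rogersRamanujanSum k = rogersRamanujanSum (k + 1) + X ^ (k + 2) * rogersRamanujanSum (k + 2) := by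
  have h := ((hasSum_rogersRamanujanSum k).sub (hasSum_rogersRamanujanSum (k + 1))).sub
    ((hasSum_rogersRamanujanSum (k + 2)).mul_left (X ^ (k + 2)))
  have := h.eq_of_telescope
    (t := fun n : ℕ => X ^ (n ^ 2 + (k + 1) * n) * (1 - X ^ n) * qTail n)
    (fun n => ((pow_dvd_pow X (by nlinarith)).mul_right _).mul_right _)
    (fun n => by rw [qTail_eq_mul n]; ring)
  simp only [pow_zero, sub_self, mul_zero, zero_mul] at this
  linear_combination this

theorem X_pow_dvd_rogersRamanujanSum_sub (k : ℕ) :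
    (X : ℤ⟦X⟧) ^ k ∣ rogersRamanujanSum k - qTail 0 := by
  have h := (hasSum_nat_add_iff' 1).mpr (hasSum_rogersRamanujanSum k)
  simp only [Finset.sum_range_one] at h
  refine HasSum.X_pow_dvd (by simpa using h) fun n => ?_
  exact (pow_dvd_pow X (by nlinarith)).mul_right _

/-- `(q)_∞` times the Rogers–Selberg series. -/
noncomputable def rogersSelbergSum (k : ℕ) : ℤ⟦X⟧ :=
  ∑' n : ℕ, (-1) ^ n * X ^ (2 * (k + 1) * n + 5 * n.choose 2 + 2 * n) * (1 - X ^ (k + 1 + 2 * n)) *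
    qFact (n + k) * qTail n

theorem hasSum_rogersSelbergSum (k : ℕ) :
    HasSum (fun n : ℕ => (-1) ^ n * X ^ (2 * (k + 1) * n + 5 * n.choose 2 + 2 * n) *
      (1 - X ^ (k + 1 + 2 * n)) * qFact (n + k) * qTail n) (rogersSelbergSum k) :=
  (summable_of_X_pow_dvd fun n => ((((pow_dvd_pow X (by nlinarith)).mul_left _).mul_right _).mul_right
    _).mul_right _).hasSum

/-- The combination telescopes termwise; the factor `1 - X ^ n` makes the telescoping term `t`
vanish at 0, so no boundary term is left. -/
theorem rogersSelbergSum_rec (k : ℕ) :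
    rogersSelbergSum k = rogersSelbergSum (k + 1) + X ^ (k + 2) * rogersSelbergSum (k + 2) := by
  have h := ((hasSum_rogersSelbergSum k).sub (hasSum_rogersSelbergSum (k + 1))).sub
    ((hasSum_rogersSelbergSum (k + 2)).mul_left (X ^ (k + 2)))
  have := h.eq_of_telescope
    (t := fun n : ℕ => (-1) ^ n * X ^ (2 * (k + 1) * n + 5 * n.choose 2 + 2 * n) * (1 - X ^ n) *
      (1 + X ^ n * (1 - X ^ (n + k + 1))) * qFact (n + k) * qTail n)
    (fun n => (((((pow_dvd_pow X (by nlinarith)).mul_left _).mul_right _).mul_right _).mul_right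
      _).mul_right _)
    (fun n => by
      rw [qTail_eq_mul n, choose_two_succ, show n + (k + 2) = n + k + 1 + 1 by ring,
        show n + (k + 1) = n + k + 1 by ring, show n + 1 + k = n + k + 1 by ring,
        qFact_succ (n + k + 1), qFact_succ (n + k)]
      ring)
  simp only [pow_zero, sub_self, mul_zero, zero_mul] at this
  linear_combination this

theorem X_pow_dvd_rogersSelbergSum_sub (k : ℕ) :
    (X : ℤ⟦X⟧) ^ k ∣ rogersSelbergSum k - qTail 0 * qTail 0 := by
  have h := (hasSum_nat_add_iff' 1).mpr (hasSum_rogersSelbergSum k)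
  simp only [Finset.sum_range_one] at h
  have h1 := HasSum.X_pow_dvd (n := k) h fun n =>
    ((((pow_dvd_pow X (by nlinarith)).mul_left _).mul_right _).mul_right _).mul_right _
  have h2 := (X_pow_dvd_qFact_sub k).mul_right (qTail 0)
  have h3 : (X : ℤ⟦X⟧) ^ k ∣ X ^ (k + 1) * (qFact k * qTail 0) :=
    (pow_dvd_pow X k.le_succ).mul_right _
  have h4 := (h1.add h2).sub h3
  convert h4 using 1
  simp
  ring

/-- Both sides satisfy the same second-order recurrence and are congruent to `(q)_∞²` modulo `X ^
k`. -/
theorem qTail_zero_mul_rogersRamanujanSum (k : ℕ) :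
    qTail 0 * rogersRamanujanSum k = rogersSelbergSum k := by
  refine eq_of_forall_eq_add_succ_succ (A := fun k => qTail 0 * rogersRamanujanSum k)
    (c := fun k => X ^ (k + 2)) (fun k => ?_) (fun k => ?_) rogersSelbergSum_rec k
  · have h := ((X_pow_dvd_rogersRamanujanSum_sub k).mul_left (qTail 0)).sub
      (X_pow_dvd_rogersSelbergSum_sub k)
    convert h using 1
    ring
  · rw [rogersRamanujanSum_rec]
    ring

/-- At `k = 0` the product `(q)_n (q^(n+1))_∞` in each Rogers–Selberg term is the constant `(q)_∞`,
which cancels. -/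
theorem hasSum_rogersRamanujanSum_zero :
    HasSum (fun n : ℕ => (-1) ^ n * X ^ (5 * n.choose 2 + 4 * n) * (1 - X ^ (2 * n + 1)))
      (rogersRamanujanSum 0) := by
  have hs : Summable (fun n : ℕ => (-1) ^ n * X ^ (5 * n.choose 2 + 4 * n) *
      (1 - X ^ (2 * n + 1)) : ℕ → ℤ⟦X⟧) :=
    summable_of_X_pow_dvd fun n => ((pow_dvd_pow X (by nlinarith)).mul_left _).mul_right _
  have h1 := hs.hasSum.mul_left (qTail 0)
  have h2 := hasSum_rogersSelbergSum 0
  rw [← qTail_zero_mul_rogersRamanujanSum] at h2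
  have e : (fun n : ℕ => (-1) ^ n * X ^ (2 * (0 + 1) * n + 5 * n.choose 2 + 2 * n) *
      (1 - X ^ (0 + 1 + 2 * n)) * qFact (n + 0) * qTail n) = fun n : ℕ => qTail 0 *
      ((-1) ^ n * X ^ (5 * n.choose 2 + 4 * n) * (1 - X ^ (2 * n + 1))) := by
    funext n
    rw [← qFact_mul_qTail n]
    ring_nf
  rw [e] at h2
  rw [mul_left_cancel₀ qTail_zero_ne_zero (h2.unique h1)]
  exact hs.hasSum

/-! ### The theta series as a product: a case of the Jacobi triple product. -/

/-- `j (5 j + 3) / 2`. -/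
def thetaExp (j : ℤ) : ℕ := (j * (5 * j + 3) / 2).toNat

theorem two_mul_thetaExp (j : ℤ) : 2 * (thetaExp j : ℤ) = j * (5 * j + 3) := by
  have h0 : 0 ≤ j * (5 * j + 3) := by
    rcases le_or_gt 0 j with h | h
    · positivity
    · nlinarith
  have h2 : 2 ∣ j * (5 * j + 3) := by
    rcases Int.even_or_odd j with h | h
    · exact h.two_dvd.mul_right _
    · obtain ⟨a, rfl⟩ := h
      exact ⟨(2 * a + 1) * (5 * a + 4), by ring⟩
  rw [thetaExp, Int.toNat_of_nonneg (by positivity)]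
  exact Int.mul_ediv_cancel' h2

theorem natAbs_le_thetaExp (j : ℤ) : j.natAbs ≤ thetaExp j := by
  have h := two_mul_thetaExp j
  zify
  rcases le_or_gt 0 j with hj | hj
  · rw [abs_of_nonneg hj]; nlinarith
  · rw [abs_of_neg hj]; nlinarith

theorem thetaExp_natCast (n : ℕ) : thetaExp n = 5 * n.choose 2 + 4 * n := by
  induction n with
  | zero => simp [thetaExp]
  | succ n ih =>
    have h1 := two_mul_thetaExp n
    have h2 := two_mul_thetaExp ((n + 1 : ℕ) : ℤ)
    rw [choose_two_succ]
    zify at ih ⊢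
    push_cast at h2 ⊢
    linarith

theorem thetaExp_neg (n : ℕ) :
    thetaExp (-((n : ℤ) + 1)) = 5 * n.choose 2 + 4 * n + (2 * n + 1) := by
  rw [← thetaExp_natCast]
  have h1 := two_mul_thetaExp n
  have h2 := two_mul_thetaExp (-((n : ℤ) + 1))
  zify
  linarith

theorem summable_int_of_X_pow_dvd {f : ℤ → ℤ⟦X⟧} (h : ∀ j, (X : ℤ⟦X⟧) ^ j.natAbs ∣ f j) :
    Summable f := by
  refine Summable.of_nat_of_neg_add_one (summable_of_X_pow_dvd fun n => ?_)
    (summable_of_X_pow_dvd fun n => ?_)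
  · simpa using h n
  · exact (pow_dvd_pow X (by omega)).trans (h (-(n + 1)))

/-- The term `(-1) ^ j q ^ (j (5 j + 3) / 2)` of the theta series. -/
noncomputable def thetaTerm (j : ℤ) : ℤ⟦X⟧ := (-1) ^ j.natAbs * X ^ thetaExp j

theorem X_pow_dvd_thetaTerm (j : ℤ) : (X : ℤ⟦X⟧) ^ j.natAbs ∣ thetaTerm j :=
  (pow_dvd_pow X (natAbs_le_thetaExp j)).mul_left _

theorem thetaTerm_natCast (n : ℕ) :
    thetaTerm n = (-1) ^ n * X ^ (5 * n.choose 2 + 4 * n) := by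
  rw [thetaTerm, thetaExp_natCast, Int.natAbs_natCast]

theorem thetaTerm_neg (n : ℕ) :
    thetaTerm (-((n : ℤ) + 1)) = -((-1) ^ n * X ^ (5 * n.choose 2 + 4 * n + (2 * n + 1))) := by
  rw [thetaTerm, thetaExp_neg, show (-((n : ℤ) + 1)).natAbs = n + 1 by omega, pow_succ]
  ring

/-- `q ^ (5 m) c_j = - q ^ (5 n + 1) c_{j + 1}` when `m = n + j + 1`. -/
theorem X_pow_mul_thetaTerm {n m : ℕ} {j : ℤ} (h : (m : ℤ) = n + j + 1) :
    X ^ (5 * m) * thetaTerm j = -(X ^ (5 * n + 1) * thetaTerm (j + 1)) := by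
  have hs : ((-1 : ℤ⟦X⟧)) ^ (j + 1).natAbs = -(-1) ^ j.natAbs := by
    rcases le_or_gt 0 j with hj | hj
    · rw [show (j + 1).natAbs = j.natAbs + 1 by omega, pow_succ]; ring
    · rw [show j.natAbs = (j + 1).natAbs + 1 by omega, pow_succ]; ring
  have he : 5 * m + thetaExp j = 5 * n + 1 + thetaExp (j + 1) := by
    have h1 := two_mul_thetaExp j
    have h2 := two_mul_thetaExp (j + 1)
    zify
    rw [h]
    linarith
  rw [thetaTerm, thetaTerm, hs, mul_left_comm, ← pow_add, he, pow_add]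
  ring

/-- The indices `n` and `-(n + 1)` pair up to the factor `1 - X ^ (2 n + 1)`. -/
theorem hasSum_thetaTerm : HasSum thetaTerm (rogersRamanujanSum 0) := by
  have h1 : Summable fun n : ℕ => thetaTerm n :=
    summable_of_X_pow_dvd fun n => X_pow_dvd_thetaTerm n
  have h2 : Summable fun n : ℕ => thetaTerm (-((n : ℤ) + 1)) :=
    summable_of_X_pow_dvd fun n =>
      (pow_dvd_pow X (by omega)).trans (X_pow_dvd_thetaTerm (-((n : ℤ) + 1)))
  have h3 := h1.hasSum.add h2.hasSum
  have e : (fun n : ℕ => thetaTerm n + thetaTerm (-((n : ℤ) + 1))) =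
      fun n : ℕ => (-1) ^ n * X ^ (5 * n.choose 2 + 4 * n) * (1 - X ^ (2 * n + 1)) := by
    funext n
    rw [thetaTerm_natCast, thetaTerm_neg]
    ring
  rw [e] at h3
  rw [hasSum_rogersRamanujanSum_zero.unique h3]
  exact h1.hasSum.of_nat_of_neg_add_one h2.hasSum

/-- `(q ^ (5 (j + 1)); q ^ 5)_∞`, which vanishes for negative `j`. -/
noncomputable def fiveTail (j : ℤ) : ℤ⟦X⟧ :=
  if 0 ≤ j then qPochhammerInf (X ^ (5 * (j.toNat + 1))) (X ^ 5) else 0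

theorem fiveTail_natCast (n : ℕ) :
    fiveTail n = qPochhammerInf (X ^ (5 * (n + 1))) (X ^ 5) := by simp [fiveTail]

theorem fiveTail_of_neg {j : ℤ} (h : j < 0) : fiveTail j = 0 := by simp [fiveTail, h]

/-- The value 0 at negative indices keeps the recurrence valid at `n = 0`, where `1 - X ^ (5 n)`
vanishes. -/
theorem fiveTail_sub_one (n : ℕ) : fiveTail (n - 1) = (1 - X ^ (5 * n)) * fiveTail n := by
  cases n with
  | zero => simp [fiveTail_of_neg]
  | succ n =>
    rw [show ((n + 1 : ℕ) : ℤ) - 1 = n by simp, fiveTail_natCast, fiveTail_natCast,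
      qPochhammerInf_X_pow_eq_mul _ (by norm_num)]
    ring_nf

/-- `∑_j (-1) ^ j q ^ (j (5 j + 3) / 2) (q ^ (5 (n + j + 1)); q ^ 5)_∞`. -/
noncomputable def thetaTailSum (n : ℕ) : ℤ⟦X⟧ := ∑' j : ℤ, thetaTerm j * fiveTail (n + j)

theorem hasSum_thetaTailSum (n : ℕ) :
    HasSum (fun j : ℤ => thetaTerm j * fiveTail (n + j)) (thetaTailSum n) :=
  (summable_int_of_X_pow_dvd fun j => (X_pow_dvd_thetaTerm j).mul_right _).hasSum

/-- Raising `n` by one changes the `j`-th tail by `X ^ (5 m)` times the tail at `m = n + j + 1`. By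
`X_pow_mul_thetaTerm` this is `-X ^ (5 n + 1)` times the summand of index `j + 1`, and the sum over
all integers is invariant under the shift. -/
theorem thetaTailSum_succ (n : ℕ) :
    thetaTailSum (n + 1) = (1 - X ^ (5 * n + 1)) * thetaTailSum n := by
  have h1 := (hasSum_thetaTailSum (n + 1)).sub (hasSum_thetaTailSum n)
  have h2 := ((Equiv.hasSum_iff (Equiv.addRight (1 : ℤ))).mpr (hasSum_thetaTailSum n)).mul_left
    (-X ^ (5 * n + 1))
  have e : (fun j : ℤ => thetaTerm j * fiveTail ((n + 1 : ℕ) + j) - thetaTerm j * fiveTail (n + j)) =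
      fun j => -X ^ (5 * n + 1) *
        ((fun j : ℤ => thetaTerm j * fiveTail (n + j)) ∘ Equiv.addRight (1 : ℤ)) j := by
    funext j
    simp only [Function.comp_apply, Equiv.coe_addRight]
    rw [show ((n + 1 : ℕ) : ℤ) + j = n + j + 1 by push_cast; ring,
      show (n : ℤ) + (j + 1) = n + j + 1 by ring]
    rcases lt_or_ge ((n : ℤ) + j + 1) 0 with h | h
    · rw [fiveTail_of_neg h, fiveTail_of_neg (by omega)]; simp
    · obtain ⟨m, hm⟩ := Int.eq_ofNat_of_zero_le h
      rw [show (n : ℤ) + j = m - 1 by omega, fiveTail_sub_one, sub_add_cancel]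
      linear_combination fiveTail m * X_pow_mul_thetaTerm hm.symm
  rw [e] at h1
  linear_combination h1.unique h2

theorem X_pow_dvd_fiveTail_sub_one (n : ℕ) : (X : ℤ⟦X⟧) ^ (5 * (n + 1)) ∣ fiveTail n - 1 := by
  rw [fiveTail_natCast]
  exact X_pow_dvd_qPochhammerInf_X_pow le_rfl (by norm_num)

theorem X_pow_dvd_thetaTailSum_sub (n : ℕ) :
    (X : ℤ⟦X⟧) ^ n ∣ thetaTailSum n - rogersRamanujanSum 0 := by
  refine ((hasSum_thetaTailSum n).sub hasSum_thetaTerm).X_pow_dvd fun j => ?_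
  rw [show thetaTerm j * fiveTail (n + j) - thetaTerm j = thetaTerm j * (fiveTail (n + j) - 1) by
    ring]
  -- If `n + j < 0`, then `|j| > n` and the theta term alone suffices; otherwise `|j|` and the order
  -- of `fiveTail - 1` add up to at least `n`.
  rcases lt_or_ge ((n : ℤ) + j) 0 with h | h
  · exact ((pow_dvd_pow X (by omega)).trans (X_pow_dvd_thetaTerm j)).mul_right _
  · obtain ⟨m, hm⟩ := Int.eq_ofNat_of_zero_le h
    rw [hm]
    refine Dvd.dvd.trans ?_ (mul_dvd_mul (X_pow_dvd_thetaTerm j) (X_pow_dvd_fiveTail_sub_one m))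
    rw [← pow_add]
    exact pow_dvd_pow X (by omega)

/-- `∑_i (-1) ^ i q ^ (4 i + 5 k i + 5 i (i - 1) / 2) (q ^ (5 (i + 1)); q ^ 5)_∞`. -/
noncomputable def eulerSum (k : ℕ) : ℤ⟦X⟧ :=
  ∑' i : ℕ, (-1) ^ i * X ^ (5 * i.choose 2 + 4 * i + 5 * k * i) * fiveTail i

theorem hasSum_eulerSum (k : ℕ) :
    HasSum (fun i : ℕ => (-1) ^ i * X ^ (5 * i.choose 2 + 4 * i + 5 * k * i) * fiveTail i)
      (eulerSum k) :=
  (summable_of_X_pow_dvd fun n => ((pow_dvd_pow X (by nlinarith)).mul_left _).mul_right _).hasSum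

/-- Euler's expansion of `(z; q⁵)_∞` at `z = q^(5k+4)`, multiplied by `(q⁵; q⁵)_∞`; this is its
functional equation under `z ↦ z q⁵`. -/
theorem eulerSum_eq_mul (k : ℕ) : eulerSum k = (1 - X ^ (5 * k + 4)) * eulerSum (k + 1) := by
  have h := ((hasSum_eulerSum k).sub (hasSum_eulerSum (k + 1))).add
    ((hasSum_eulerSum (k + 1)).mul_left (X ^ (5 * k + 4)))
  have := h.eq_of_telescope
    (t := fun n : ℕ => (-1) ^ n * X ^ (5 * n.choose 2 + 4 * n + 5 * k * n) * (1 - X ^ (5 * n)) *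
      fiveTail n)
    (fun n => ((((pow_dvd_pow X (by nlinarith)).mul_left _).mul_right _).mul_right _))
    (fun n => by
      have h5 := fiveTail_sub_one (n + 1)
      rw [show ((n + 1 : ℕ) : ℤ) - 1 = n by simp] at h5
      rw [choose_two_succ, h5]
      ring)
  simp only [mul_zero, pow_zero, sub_self, zero_mul] at this
  linear_combination this

theorem eulerSum_zero :
    eulerSum 0 = qPochhammerInf (X ^ 5) (X ^ 5) * qPochhammerInf (X ^ 4) (X ^ 5) := by
  have h5 : (5 : ℕ) ≠ 0 := by norm_num
  have h := eq_of_forall_eq_mul_succ (A := eulerSum)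
    (B := fun k => qPochhammerInf (X ^ 5) (X ^ 5) * qPochhammerInf (X ^ (5 * k + 4)) (X ^ 5))
    (c := fun k => 1 - X ^ (5 * k + 4)) (fun k => ?_) eulerSum_eq_mul (fun k => ?_) 0
  · simpa using h
  · have h1 := (hasSum_nat_add_iff' 1).mpr (hasSum_eulerSum k)
    simp only [Finset.sum_range_one] at h1
    have h2 := HasSum.X_pow_dvd (n := k) h1 fun n =>
      ((pow_dvd_pow X (by nlinarith)).mul_left _).mul_right _
    have h3 := (X_pow_dvd_qPochhammerInf_X_pow (m := k) (i := 5 * k + 4) (by omega) h5).mul_left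
      (qPochhammerInf (X ^ 5) (X ^ 5))
    have h4 := h2.sub h3
    have h0 : fiveTail ((0 : ℕ) : ℤ) = qPochhammerInf (X ^ 5) (X ^ 5) := by
      rw [fiveTail_natCast]
    convert h4 using 1
    rw [h0]
    simp
    ring
  · rw [qPochhammerInf_X_pow_eq_mul (5 * k + 4) h5]
    ring_nf

theorem thetaTailSum_zero : thetaTailSum 0 = eulerSum 0 := by
  have h1 : HasSum (fun n : ℕ => thetaTerm n * fiveTail n) (eulerSum 0) := by
    simpa [thetaTerm_natCast] using hasSum_eulerSum 0
  have h2 : HasSum (fun n : ℕ => thetaTerm (-((n : ℤ) + 1)) * fiveTail (-((n : ℤ) + 1))) 0 := by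
    have e (n : ℕ) : fiveTail (-((n : ℤ) + 1)) = 0 := fiveTail_of_neg (by omega)
    simp only [e, mul_zero]
    exact hasSum_zero
  have h3 := HasSum.of_nat_of_neg_add_one (f := fun j : ℤ => thetaTerm j * fiveTail j) h1 h2
  have h4 := hasSum_thetaTailSum 0
  simp only [Nat.cast_zero, zero_add] at h4
  simpa using h4.unique h3

/-- The product of `thetaTailSum n` and `(q^(5n+1); q⁵)_∞` does not depend on `n`. At `n = 0`
Euler's expansion evaluates it, and for growing `n` it tends to the theta series. -/
theorem rogersRamanujanSum_zero :
    rogersRamanujanSum 0 = qPochhammerInf X (X ^ 5) * qPochhammerInf (X ^ 4) (X ^ 5) *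
      qPochhammerInf (X ^ 5) (X ^ 5) := by
  have h5 : (5 : ℕ) ≠ 0 := by norm_num
  have hU : ∀ n, eulerSum 0 * qPochhammerInf X (X ^ 5) =
      thetaTailSum n * qPochhammerInf (X ^ (5 * n + 1)) (X ^ 5) := by
    intro n
    induction n with
    | zero => simp [thetaTailSum_zero]
    | succ n ih =>
      rw [ih, thetaTailSum_succ, qPochhammerInf_X_pow_eq_mul (5 * n + 1) h5]
      ring_nf
  have h : rogersRamanujanSum 0 = eulerSum 0 * qPochhammerInf X (X ^ 5) := by
    refine eq_of_forall_X_pow_dvd_sub fun n => ?_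
    have h1 := (X_pow_dvd_qPochhammerInf_X_pow (m := n) (i := 5 * n + 1) (by omega) h5).mul_left
      (thetaTailSum n)
    have h2 := ((X_pow_dvd_thetaTailSum_sub n).add h1).neg_right
    rw [hU n]
    convert h2 using 1
    ring
  rw [h, eulerSum_zero]
  ring

/-! ### Explicit solution of the q-difference system. -/

theorem HasSum.eq_of_forall_eq {f g : ℕ → ℤ⟦X⟧} {s t : ℤ⟦X⟧} (hf : HasSum f s) (hg : HasSum g t)
    (h : ∀ n, f n = g n) : s = t := by
  rw [funext h] at hf
  exact hf.unique hg

/-- `(q)_∞ ∑ q ^ (k n + n² + n) (-q)_n (-q ^ (k + n + 1))_∞ / (q)_n`. -/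
noncomputable def redSeries (k : ℕ) : ℤ⟦X⟧ :=
  ∑' n : ℕ, X ^ (k * n + n ^ 2 + n) * qFactNeg n * qTail n * qTailNeg (k + n)

/-- `(q)_∞ (-q ^ (k + 1))_∞ +
2 (q)_∞ ∑_{n ≥ 1} q ^ (k n + n² + n) (-q)_{n - 1} (-q ^ (k + n + 1))_∞ / (q)_n`. -/
noncomputable def blueSeries (k : ℕ) : ℤ⟦X⟧ :=
  qTail 0 * qTailNeg k + ∑' n : ℕ, 2 * X ^ (k * (n + 1) + (n + 1) * (n + 2)) * qFactNeg n *
    qTail (n + 1) * qTailNeg (k + n + 1)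

theorem hasSum_redSeries (k : ℕ) :
    HasSum (fun n : ℕ => X ^ (k * n + n ^ 2 + n) * qFactNeg n * qTail n * qTailNeg (k + n))
      (redSeries k) :=
  (summable_of_X_pow_dvd fun n =>
    (((pow_dvd_pow X (by nlinarith)).mul_right _).mul_right _).mul_right _).hasSum

theorem hasSum_blueSeries (k : ℕ) :
    HasSum (fun n : ℕ => 2 * X ^ (k * (n + 1) + (n + 1) * (n + 2)) * qFactNeg n *
      qTail (n + 1) * qTailNeg (k + n + 1)) (blueSeries k - qTail 0 * qTailNeg k) := by
  rw [blueSeries, add_sub_cancel_left]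
  exact (summable_of_X_pow_dvd fun n =>
    ((((pow_dvd_pow X (by nlinarith)).mul_left _).mul_right _).mul_right _).mul_right _).hasSum

/-- Holds term by term: the remaining factor `1 - X ^ (n + 1)` turns `qTail (n + 1)` into `qTail n`,
and the two leading terms cancel. -/
theorem blueSeries_rec (k : ℕ) :
    blueSeries k = (1 + X ^ (k + 1)) * blueSeries (k + 1) + 2 * X ^ (k + 2) * redSeries (k + 2) := by
  have h1 := (hasSum_blueSeries k).sub ((hasSum_blueSeries (k + 1)).mul_left (1 + X ^ (k + 1)))
  have h2 := (hasSum_redSeries (k + 2)).mul_left (2 * X ^ (k + 2))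
  have e := h1.eq_of_forall_eq h2 (fun n => by
    rw [show k + 1 + n + 1 = k + n + 1 + 1 by ring, show k + 2 + n = k + n + 1 + 1 by ring,
      qTailNeg_eq_mul (k + n + 1), qTail_eq_mul n]
    ring)
  rw [qTailNeg_eq_mul k] at e
  linear_combination e

/-- Here the terms only telescope; the value of `t` at 0 is the leading term of `blueSeries (k +
1)`. -/
theorem redSeries_rec (k : ℕ) :
    redSeries k = X ^ (k + 1) * redSeries (k + 1) + X ^ (k + 2) * redSeries (k + 2) +
      blueSeries (k + 1) := by
  have h1 := (((hasSum_redSeries k).sub ((hasSum_redSeries (k + 1)).mul_left (X ^ (k + 1)))).sub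
    ((hasSum_redSeries (k + 2)).mul_left (X ^ (k + 2)))).sub (hasSum_blueSeries (k + 1))
  have := h1.eq_of_telescope
    (t := fun n : ℕ => X ^ (k * n + n ^ 2 + n) * qFactNeg n * qTail n * qTailNeg (k + n + 1))
    (fun n => ((((pow_dvd_pow X (by nlinarith)).mul_right _).mul_right _).mul_right _))
    (fun n => by
      rw [show k + 1 + n = k + n + 1 by ring, show k + 2 + n = k + n + 1 + 1 by ring,
        show k + (n + 1) + 1 = k + n + 1 + 1 by ring, qTailNeg_eq_mul (k + n),
        qTailNeg_eq_mul (k + n + 1), qFactNeg_succ, qTail_eq_mul n]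
      ring)
  simp at this
  linear_combination this

theorem X_pow_dvd_redSeries_sub (k : ℕ) : (X : ℤ⟦X⟧) ^ k ∣ redSeries k - qTail 0 := by
  have h1 := (hasSum_nat_add_iff' 1).mpr (hasSum_redSeries k)
  simp only [Finset.sum_range_one] at h1
  have h2 := HasSum.X_pow_dvd (n := k) h1 fun n =>
    (((pow_dvd_pow X (by nlinarith)).mul_right _).mul_right _).mul_right _
  have h3 := ((pow_dvd_pow X k.le_succ).trans (X_pow_dvd_qTailNeg_sub_one k)).mul_left (qTail 0)
  convert h2.add h3 using 1
  simp
  ring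

theorem X_pow_dvd_blueSeries_sub (k : ℕ) : (X : ℤ⟦X⟧) ^ k ∣ blueSeries k - qTail 0 := by
  have h2 := HasSum.X_pow_dvd (n := k) (hasSum_blueSeries k) fun n =>
    ((((pow_dvd_pow X (by nlinarith)).mul_left _).mul_right _).mul_right _).mul_right _
  have h3 := ((pow_dvd_pow X k.le_succ).trans (X_pow_dvd_qTailNeg_sub_one k)).mul_left (qTail 0)
  convert h2.add h3 using 1
  ring

theorem redSeries_zero : redSeries 0 = qTailNeg 0 * rogersRamanujanSum 0 := by
  refine (hasSum_redSeries 0).eq_of_forall_eq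
    ((hasSum_rogersRamanujanSum 0).mul_left (qTailNeg 0)) fun n => ?_
  rw [← qFactNeg_mul_qTailNeg n, zero_add]
  ring

/-- The system of `q`-difference equations determines its solution. -/
theorem eq_redSeries_of_rec {E D : ℕ → ℤ⟦X⟧} (hE0 : ∀ k, (X : ℤ⟦X⟧) ^ k ∣ E k - 1)
    (hD0 : ∀ k, (X : ℤ⟦X⟧) ^ k ∣ D k - 1)
    (hE : ∀ k, E k = X ^ (k + 1) * E (k + 1) + X ^ (k + 2) * E (k + 2) + D (k + 1))
    (hD : ∀ k, D k = (1 + X ^ (k + 1)) * D (k + 1) + 2 * X ^ (k + 2) * E (k + 2)) (k : ℕ) :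
    qTail 0 * E k = redSeries k := by
  -- Downward induction on `k` for both congruences at once, since the equations are coupled; `j`
  -- bounds the distance from `k` up to `n`.
  have key : ∀ n j k, n ≤ k + j → (X : ℤ⟦X⟧) ^ n ∣ qTail 0 * E k - redSeries k ∧
      (X : ℤ⟦X⟧) ^ n ∣ qTail 0 * D k - blueSeries k := by
    intro n j
    induction j with
    | zero =>
      intro k hk
      have hk' : (X : ℤ⟦X⟧) ^ n ∣ X ^ k := pow_dvd_pow X hk
      refine ⟨hk'.trans ?_, hk'.trans ?_⟩
      · convert ((hE0 k).mul_left (qTail 0)).sub (X_pow_dvd_redSeries_sub k) using 1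
        ring
      · convert ((hD0 k).mul_left (qTail 0)).sub (X_pow_dvd_blueSeries_sub k) using 1
        ring
    | succ j ih =>
      intro k hk
      obtain ⟨hE1, hD1⟩ := ih (k + 1) (by omega)
      obtain ⟨hE2, -⟩ := ih (k + 2) (by omega)
      constructor
      · convert ((hE1.mul_left (X ^ (k + 1))).add (hE2.mul_left (X ^ (k + 2)))).add hD1 using 1
        rw [hE k, redSeries_rec k]
        ring
      · convert (hD1.mul_left (1 + X ^ (k + 1))).add (hE2.mul_left (2 * X ^ (k + 2))) using 1
        rw [hD k, blueSeries_rec k]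
        ring
  exact eq_of_forall_X_pow_dvd_sub fun n => (key n n k (by omega)).1

/-! ### Admissible sets of parts and their recurrences. -/

/-- The least admissible difference between a part of color `c` and a larger part of color `d`. -/
def minDiff : PartColor → PartColor → ℕ
  | .B, .R => 2
  | .B, .G => 2
  | .B, .B => 1
  | _, .R => 3
  | _, .G => 1
  | _, .B => 2

/-- The part `b` may occur above the part `a`. -/
def MayFollow (a b : ℕ × PartColor) : Prop := a.1 + minDiff a.2 b.2 ≤ b.1

theorem one_le_minDiff (c d : PartColor) : 1 ≤ minDiff c d := by cases c <;> cases d <;> decide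

theorem MayFollow.lt {a b : ℕ × PartColor} (h : MayFollow a b) : a.1 < b.1 := by
  have := one_le_minDiff a.2 b.2
  unfold MayFollow at h
  omega

/-- The sets of parts that may occur together in an element of `Γ`, all satisfying `P`. -/
def Admissible (P : ℕ × PartColor → Prop) : Set (Finset (ℕ × PartColor)) :=
  {s | (∀ b ∈ s, P b) ∧ ∀ b ∈ s, ∀ c ∈ s, b ≠ c → MayFollow b c ∨ MayFollow c b}

/-- The sum of the sizes of a set of parts. -/
def partsWeight (s : Finset (ℕ × PartColor)) : ℕ := ∑ a ∈ s, a.1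

/-- The elements of weight `n` of a collection of sets of parts. -/
def ofWeight (T : Set (Finset (ℕ × PartColor))) (n : ℕ) : Set (Finset (ℕ × PartColor)) :=
  {s ∈ T | partsWeight s = n}

/-- The generating function of a collection of sets of parts. -/
noncomputable def weightGenFun (T : Set (Finset (ℕ × PartColor))) : ℤ⟦X⟧ :=
  PowerSeries.mk fun n => ((ofWeight T n).ncard : ℤ)

theorem le_partsWeight {s : Finset (ℕ × PartColor)} {b : ℕ × PartColor} (hb : b ∈ s) :
    b.1 ≤ partsWeight s :=
  Finset.single_le_sum (f := Prod.fst) (fun _ _ => Nat.zero_le _) hb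

theorem finite_ofWeight (T : Set (Finset (ℕ × PartColor))) (n : ℕ) : (ofWeight T n).Finite := by
  refine (Finset.finite_toSet
    (Finset.range (n + 1) ×ˢ (Finset.univ : Finset PartColor)).powerset).subset fun s hs => ?_
  rw [Finset.mem_coe, Finset.mem_powerset]
  intro b hb
  have := le_partsWeight hb
  rw [hs.2] at this
  simp
  omega

/-- Every part exceeds `k`, so only the empty set has weight below `k`. -/
theorem X_pow_dvd_weightGenFun_sub_one (k : ℕ) (c : PartColor) :
    (X : ℤ⟦X⟧) ^ k ∣ weightGenFun (Admissible (MayFollow (k, c))) - 1 := by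
  rw [X_pow_dvd_iff]
  intro n hn
  have e : ofWeight (Admissible (MayFollow (k, c))) n = if n = 0 then {∅} else ∅ := by
    ext s
    rcases s.eq_empty_or_nonempty with rfl | ⟨b, hb⟩
    · split_ifs with h0 <;> simp [ofWeight, Admissible, partsWeight, h0, eq_comm]
    · have h1 := le_partsWeight hb
      have h2 : s ≠ ∅ := Finset.ne_empty_of_mem hb
      have h3 : s ∉ ofWeight (Admissible (MayFollow (k, c))) n := fun h => by
        have h4 := (h.1.1 b hb).lt
        rw [h.2] at h1
        simp only at h4
        omega
      split_ifs <;> simp [h2, h3]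
  rw [map_sub, weightGenFun, coeff_mk, coeff_one, e]
  split_ifs <;> simp

theorem notMem_of_mem_admissible {b : ℕ × PartColor} {s : Finset (ℕ × PartColor)}
    (h : s ∈ Admissible (MayFollow b)) : b ∉ s := fun hb => lt_irrefl _ (h.1 b hb).lt

/-- Deleting `b` is a bijection: by `hc` no part satisfying `P` lies below `b`, so all other parts
of an admissible set containing `b` must follow it. -/
theorem ncard_ofWeight_insert {P : ℕ × PartColor → Prop} {b : ℕ × PartColor} (hP : P b)
    (hb : ∀ c, MayFollow b c → P c) (hc : ∀ c, P c → ¬ MayFollow c b) (n : ℕ) :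
    (ofWeight (Admissible (MayFollow b)) n).ncard =
      (ofWeight {s ∈ Admissible P | b ∈ s} (n + b.1)).ncard := by
  refine Set.ncard_congr (fun s _ => insert b s) ?_ ?_ ?_
  · rintro s ⟨hs, hw⟩
    have hbs := notMem_of_mem_admissible hs
    refine ⟨⟨⟨?_, ?_⟩, Finset.mem_insert_self _ _⟩, ?_⟩
    · intro c hcs
      rcases Finset.mem_insert.mp hcs with rfl | h
      · exact hP
      · exact hb c (hs.1 c h)
    · intro c hcs d hds hne
      rcases Finset.mem_insert.mp hcs with rfl | h
      · rcases Finset.mem_insert.mp hds with rfl | h'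
        · exact absurd rfl hne
        · exact Or.inl (hs.1 d h')
      · rcases Finset.mem_insert.mp hds with rfl | h'
        · exact Or.inr (hs.1 c h)
        · exact hs.2 c h d h' hne
    · unfold partsWeight at hw ⊢
      rw [Finset.sum_insert hbs, hw]
      omega
  · rintro s t ⟨hs, -⟩ ⟨ht, -⟩ h
    rw [← Finset.erase_insert (notMem_of_mem_admissible hs), h,
      Finset.erase_insert (notMem_of_mem_admissible ht)]
  · rintro s ⟨⟨hs, hbs⟩, hw⟩
    refine ⟨s.erase b, ⟨⟨fun c h => ?_, fun c h d h' => ?_⟩, ?_⟩, Finset.insert_erase hbs⟩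
    · obtain ⟨hne, hcs⟩ := Finset.mem_erase.mp h
      exact (hs.2 c hcs b hbs hne).resolve_left (hc c (hs.1 c hcs))
    · exact hs.2 c (Finset.mem_of_mem_erase h) d (Finset.mem_of_mem_erase h')
    · unfold partsWeight at hw ⊢
      have := Finset.add_sum_erase s Prod.fst hbs
      omega

theorem weightGenFun_mem {P : ℕ × PartColor → Prop} {b : ℕ × PartColor} (hP : P b)
    (hb : ∀ c, MayFollow b c → P c) (hc : ∀ c, P c → ¬ MayFollow c b) :
    weightGenFun {s ∈ Admissible P | b ∈ s} =
      X ^ b.1 * weightGenFun (Admissible (MayFollow b)) := by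
  ext n
  rw [coeff_X_pow_mul', weightGenFun, coeff_mk, weightGenFun]
  split_ifs with hn
  · rw [coeff_mk, ncard_ofWeight_insert hP hb hc, Nat.sub_add_cancel hn]
  · rw [Nat.cast_eq_zero, Set.ncard_eq_zero (finite_ofWeight _ n)]
    refine Set.eq_empty_of_forall_notMem ?_
    rintro s ⟨⟨-, hbs⟩, rfl⟩
    exact hn (le_partsWeight hbs)

theorem weightGenFun_union {S T : Set (Finset (ℕ × PartColor))} (h : Disjoint S T) :
    weightGenFun (S ∪ T) = weightGenFun S + weightGenFun T := by
  ext n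
  have e : ofWeight (S ∪ T) n = ofWeight S n ∪ ofWeight T n := by
    ext s; simp [ofWeight, or_and_right]
  rw [map_add, weightGenFun, weightGenFun, weightGenFun, coeff_mk, coeff_mk, coeff_mk, e,
    Set.ncard_union_eq (h.mono (fun _ h => h.1) fun _ h => h.1) (finite_ofWeight S n)
      (finite_ofWeight T n)]
  push_cast
  rfl

/-- Sort the admissible sets by whether they contain a part `b` that is minimal for `P`. -/
theorem weightGenFun_admissible {P : ℕ × PartColor → Prop} {b : ℕ × PartColor} (hP : P b)
    (hb : ∀ c, MayFollow b c → P c) (hc : ∀ c, P c → ¬ MayFollow c b) :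
    weightGenFun (Admissible P) = X ^ b.1 * weightGenFun (Admissible (MayFollow b)) +
      weightGenFun (Admissible fun c => P c ∧ c ≠ b) := by
  rw [← weightGenFun_mem hP hb hc, ← weightGenFun_union]
  · congr 1
    ext s
    have e : s ∈ Admissible (fun c => P c ∧ c ≠ b) ↔ s ∈ Admissible P ∧ b ∉ s := by
      constructor
      · exact fun h => ⟨⟨fun c hc => (h.1 c hc).1, h.2⟩, fun hb => (h.1 b hb).2 rfl⟩
      · exact fun h => ⟨fun c hc => ⟨h.1.1 c hc, fun h' => h.2 (h' ▸ hc)⟩, h.1.2⟩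
    rw [Set.mem_union, e, Set.mem_ofPred_eq]
    tauto
  · rw [Set.disjoint_left]
    exact fun s h h' => (h'.1 b h.2).2 rfl

theorem mayFollow_green (k : ℕ) : MayFollow (k, .G) = MayFollow (k, .R) := by
  funext ⟨j, c⟩
  cases c <;> rfl

/-- Split off `(k+1)_G`, then `(k+2)_G`. Green and red impose the same condition on larger parts,
and what is left is exactly what may follow `(k+1)_B`. -/
theorem weightGenFun_red (k : ℕ) :
    weightGenFun (Admissible (MayFollow (k, .R))) =
      X ^ (k + 1) * weightGenFun (Admissible (MayFollow (k + 1, .R))) +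
      X ^ (k + 2) * weightGenFun (Admissible (MayFollow (k + 2, .R))) +
      weightGenFun (Admissible (MayFollow (k + 1, .B))) := by
  have e : (fun c => (MayFollow (k, .R) c ∧ c ≠ (k + 1, .G)) ∧ c ≠ (k + 2, .G)) =
      MayFollow (k + 1, .B) := by
    funext ⟨j, c⟩
    cases c <;> simp [MayFollow, minDiff] <;> omega
  rw [weightGenFun_admissible (P := MayFollow (k, .R)) (b := (k + 1, .G)),
    weightGenFun_admissible (P := fun c => MayFollow (k, .R) c ∧ c ≠ (k + 1, .G))
      (b := (k + 2, .G)), mayFollow_green, mayFollow_green, e, ← add_assoc]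
  all_goals try rintro ⟨j, c⟩; cases c
  all_goals simp [MayFollow, minDiff]
  all_goals omega

/-- Split off `(k+1)_B`, `(k+2)_R` and `(k+2)_G`. The last two contribute equally, whence the 2; the
first and the remainder both leave the condition of `(k+1)_B`. -/
theorem weightGenFun_blue (k : ℕ) :
    weightGenFun (Admissible (MayFollow (k, .B))) =
      (1 + X ^ (k + 1)) * weightGenFun (Admissible (MayFollow (k + 1, .B))) +
      2 * X ^ (k + 2) * weightGenFun (Admissible (MayFollow (k + 2, .R))) := by
  have e : (fun c => ((MayFollow (k, .B) c ∧ c ≠ (k + 1, .B)) ∧ c ≠ (k + 2, .R)) ∧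
      c ≠ (k + 2, .G)) = MayFollow (k + 1, .B) := by
    funext ⟨j, c⟩
    cases c <;> simp [MayFollow, minDiff] <;> omega
  rw [weightGenFun_admissible (P := MayFollow (k, .B)) (b := (k + 1, .B)),
    weightGenFun_admissible (P := fun c => MayFollow (k, .B) c ∧ c ≠ (k + 1, .B))
      (b := (k + 2, .R)),
    weightGenFun_admissible
      (P := fun c => (MayFollow (k, .B) c ∧ c ≠ (k + 1, .B)) ∧ c ≠ (k + 2, .R))
      (b := (k + 2, .G)), mayFollow_green, e]
  · ring
  all_goals try rintro ⟨j, c⟩; cases c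
  all_goals simp [MayFollow, minDiff]
  all_goals omega

theorem aStar_eq_ncard (n : ℕ) :
    AStar n = (ofWeight (Admissible (MayFollow (0, .R))) n).ncard := by
  symm
  unfold AStar
  refine Set.ncard_congr (fun s hs => ⟨s.val, fun b hb => ?_, hs.2⟩) ?_ ?_ ?_
  · have := (hs.1.1 b hb).lt
    omega
  · rintro s ⟨⟨hs, hp⟩, hw⟩
    have hne : ∀ j c k d, j < k → k < j + minDiff c d → ¬ ContainsPair s.val j c k d := by
      rintro j c k d hjk hkj ⟨h1, h2⟩
      rcases hp _ h1 _ h2 (by simp [hjk.ne]) with h | h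
      · simp only [MayFollow] at h
        omega
      · have := h.lt
        simp only at this
        omega
    refine ⟨⟨?_, fun j => hne _ _ _ _ ?_ ?_, fun j => hne _ _ _ _ ?_ ?_,
      fun j => hne _ _ _ _ ?_ ?_, fun j => hne _ _ _ _ ?_ ?_, fun j => hne _ _ _ _ ?_ ?_,
      fun j => hne _ _ _ _ ?_ ?_, fun j => hne _ _ _ _ ?_ ?_, fun j => hne _ _ _ _ ?_ ?_⟩,
      fun h => ?_, fun h => ?_, fun h => ?_⟩
    · refine Multiset.Nodup.map_on (fun a ha b hb hab => ?_) s.nodup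
      by_contra hne'
      rcases hp a ha b hb hne' with h | h <;> exact absurd h.lt (by omega)
    any_goals simp [minDiff]
    all_goals
      have := hs _ h
      simp [MayFollow, minDiff] at this
  · intro s t _ _ h
    exact Finset.val_injective (congrArg ColoredPartition.parts h)
  · rintro ⟨s, hpos, hsum⟩ ⟨hΓ, h1, h2, h3⟩
    have hnd : s.Nodup := Multiset.Nodup.of_map _ hΓ.distinct
    refine ⟨⟨s, hnd⟩, ⟨⟨?_, ?_⟩, hsum⟩, rfl⟩
    · rintro ⟨j, c⟩ hb
      have hj := hpos _ hb
      simp only at hj h1 h2 h3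
      have hj1 : j = 1 → (1, c) ∈ s := by rintro rfl; exact hb
      have hj2 : j = 2 → (2, c) ∈ s := by rintro rfl; exact hb
      by_contra hcon
      cases c <;> simp only [MayFollow, minDiff] at hcon <;> grind
    · have key : ∀ b ∈ s, ∀ c ∈ s, b.1 < c.1 → MayFollow b c := by
        rintro ⟨j, c⟩ hb ⟨k, d⟩ hd hlt
        simp only at hlt
        -- No value of `minDiff` exceeds 3, so a violation can only occur at distance 1 or 2.
        have hk1 : k = j + 1 → ContainsPair s j c (j + 1) d := by rintro rfl; exact ⟨hb, hd⟩
        have hk2 : k = j + 2 → ContainsPair s j c (j + 2) d := by rintro rfl; exact ⟨hb, hd⟩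
        obtain ⟨-, a1, a2, a3, a4, a5, a6, a7, a8⟩ := hΓ
        specialize a1 j; specialize a2 j; specialize a3 j; specialize a4 j
        specialize a5 j; specialize a6 j; specialize a7 j; specialize a8 j
        by_contra hcon
        cases c <;> cases d <;> simp only [MayFollow, minDiff] at hcon <;> grind
      intro b hb c hc hne
      rcases lt_trichotomy b.1 c.1 with h | h | h
      · exact Or.inl (key b hb c hc h)
      · exact absurd (Multiset.inj_on_of_nodup_map hΓ.distinct b hb c hc h) hne
      · exact Or.inr (key c hc b hb h)

theorem qTail_zero_mul_aStar :
    qTail 0 * (PowerSeries.mk fun n : ℕ => (AStar n : ℤ)) =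
      qTailNeg 0 * rogersRamanujanSum 0 := by
  have e : (PowerSeries.mk fun n : ℕ => (AStar n : ℤ)) =
      weightGenFun (Admissible (MayFollow (0, .R))) := by
    simp only [weightGenFun, aStar_eq_ncard]
  rw [e, ← redSeries_zero]
  exact eq_redSeries_of_rec (E := fun k => weightGenFun (Admissible (MayFollow (k, .R))))
    (D := fun k => weightGenFun (Admissible (MayFollow (k, .B))))
    (fun k => X_pow_dvd_weightGenFun_sub_one k _) (fun k => X_pow_dvd_weightGenFun_sub_one k _)
    weightGenFun_red weightGenFun_blue 0

theorem theorem2 :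
    IsUnit (qPochhammerInf PowerSeries.X (PowerSeries.X ^ 2) *
      (qPochhammerInf (PowerSeries.X ^ 2) (PowerSeries.X ^ 5) *
        qPochhammerInf (PowerSeries.X ^ 3) (PowerSeries.X ^ 5))) ∧
    (PowerSeries.mk fun n : ℕ => (AStar n : ℤ)) =
      Ring.inverse (qPochhammerInf PowerSeries.X (PowerSeries.X ^ 2) *
        (qPochhammerInf (PowerSeries.X ^ 2) (PowerSeries.X ^ 5) *
          qPochhammerInf (PowerSeries.X ^ 3) (PowerSeries.X ^ 5))) := by
  set A : ℤ⟦X⟧ := PowerSeries.mk fun n : ℕ => (AStar n : ℤ) with hA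
  set P : ℤ⟦X⟧ := qPochhammerInf PowerSeries.X (PowerSeries.X ^ 2) *
      (qPochhammerInf (PowerSeries.X ^ 2) (PowerSeries.X ^ 5) *
        qPochhammerInf (PowerSeries.X ^ 3) (PowerSeries.X ^ 5)) with hP
  have h : A * P = 1 := by
    apply mul_left_cancel₀ qTail_zero_ne_zero
    have h1 := qTail_zero_mul_aStar
    rw [rogersRamanujanSum_zero] at h1
    rw [← mul_assoc, hA, h1, hP]
    -- The residues 1, 4, 5 from Rogers–Ramanujan and 2, 3 from `P` assemble to `(q)_∞`; Euler's
    -- identity removes the rest.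
    linear_combination qTailNeg 0 * qPochhammerInf X (X ^ 2) * qTail_zero_eq_prod_mod_five +
      qTail 0 * qTailNeg_zero_mul_qPochhammerInf
  have hu : IsUnit P := IsUnit.of_mul_eq_one_right A h
  refine ⟨hu, ?_⟩
  rw [← one_mul (Ring.inverse P)]
  exact (Ring.eq_mul_inverse_iff_mul_eq _ _ _ hu).mpr h
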